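/- Let $d\in\{2,3\}$ and let $\Omega\subset\mathbb R^d$ be a bounded open set. Write $(\cdot,\cdot)$ and $\|\cdot\|$ for the $L^2(\Omega)$ inner product and norm (of scalar, vector and matrix fields, with Euclidean/Frobenius norms of the values), $X=[H^1_0(\Omega)]^d$ (the closure of $[C_c^\infty(\Omega)]^d$ in $[H^1(\Omega)]^d$), $Q=\{q\in L^2(\Omega):\int_\Omega q\,dx=0\}$, $\|f\|_{-1}=\sup_{0\ne v\in X}(f,v)/\|\nabla v\|$ for $f$ in the dual $H^{-1}$ of $X$, and $$b^*(w,u,v)=\tfrac12(w\cdot\nabla u,v)-\tfrac12(w\cdot\nabla v,u).$$ There is a constant $C_{b^*}>0$, depending only on $\Omega$, such that for all $u,v,w\in X$ $$b^*(w,u,v)\le C_{b^*}\|\nabla w\|\,\|\nabla u\|\,(\|v\|\,\|\nabla v\|)^{1/2},\qquad b^*(w,u,v)\le C_{b^*}(\|w\|\,\|\nabla w\|)^{1/2}\|\nabla u\|\,\|\nabla v\| .\qquad (1)$$ Fix any constant $C_{b^*}$ for which (1) holds. Let $X_h\subset X$ and $Q_h\subset Q$ be finite-dimensional subspaces, let the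 snapshots $u_{h,S}^{k,l}$ ($1\le k\le J_S$, $0\le l\le N_S$) be elements of $V_h=\{v\in X_h:(\nabla\cdot v,q)=0\ \forall q\in Q_h\}$, let $\varphi_1,\dots,\varphi_R$ be a POD basis, i.e. an $L^2$-orthonormal family in the span of the snapshots that minimizes $\sum_{k,l}\|u_{h,S}^{k,l}-\sum_{i=1}^R(u_{h,S}^{k,l},\varphi_i)\varphi_i\|^2$ among all such families, and let $X_R=\mathrm{span}\{\varphi_1,\dots,\varphi_R\}$. Let $\mathbb S_R=\big((\nabla\varphi_i,\nabla\varphi_j)\big)_{i,j}$ be the POD stiffness matrix and $|||\cdot|||_2$ the matrix 2-norm. For $\delta>0$ and $v\in X$ let $\overline v\in X_R$ be the ROM differential filter of $v$, i.e. the unique element of $X_R$ with $\delta^2(\nabla\overline v,\nabla\varphi)+(\overline v,\varphi)=(v,\varphi)$ for all $\varphi\in X_R$. Let $\nu_1,\dots,\nu_J>0$, $\nu_{max}=\max_j\nu_j$, $\Delta t>0$, $N\ge1$, and let $f^{j,n}\in H^{-1}$. For $1\le j\le J$ let $u_R^{j,0},\dots,u_R^{j,N}\in X_R$ solve the Leray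 ensemble-POD scheme: with $\langle u_R\rangle^n=\frac1J\sum_{j=1}^Ju_R^{j,n}$, for all $0\le n\le N-1$ and all $\varphi\in X_R$, $$\begin{aligned}&\Big(\frac{u_R^{j,n+1}-u_R^{j,n}}{\Delta t},\varphi\Big)+b^*\big(\overline{\langle u_R\rangle^n},u_R^{j,n+1},\varphi\big)+b^*\big(\overline{u_R^{j,n}-\langle u_R\rangle^n},u_R^{j,n},\varphi\big)\\&\quad+\nu_{max}(\nabla u_R^{j,n+1},\nabla\varphi)+(\nu_j-\nu_{max})(\nabla u_R^{j,n},\nabla\varphi)=(f^{j,n+1},\varphi).\end{aligned}$$ Define $\epsilon$ by $\max_{1\le j\le J}|\nu_j-\nu_{max}|/\nu_{max}=1-\epsilon$ (so $0<\epsilon\le1$), and assume that for all $1\le j\le J$ and $0\le n\le N-1$ $$\frac{C_{b^*}^2\,\Delta t}{\nu_{max}}\,|||\mathbb S_R|||_2^{1/2}\,\big\|\nabla\big(\overline{u_R^{j,n}-\langle u_R\rangle^n}\big)\big\|^2\le\epsilon .$$ Then for every $1\le j\le J$ $$\begin{aligned}&\frac12\|u_R^{j,N}\|^2+\frac{\nu_{max}\Delta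 t}{2}\|\nabla u_R^{j,N}\|^2+\frac{\epsilon\,\nu_{max}\,\Delta t}{4}\sum_{n=0}^{N-1}\|\nabla u_R^{j,n+1}\|^2\\&\quad\le\sum_{n=0}^{N-1}\frac{\Delta t}{\nu_{max}\,\epsilon}\|f^{j,n+1}\|_{-1}^2+\frac12\|u_R^{j,0}\|^2+\frac{\nu_{max}\Delta t}{2}\|\nabla u_R^{j,0}\|^2 .\end{aligned}$$ -/

import Mathlib

open MeasureTheory
open scoped ContDiff

namespace LerayPOD

/-- Points of `ℝ^d` and values of vector fields, with the Euclidean norm. -/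
abbrev Vec (d : ℕ) := EuclideanSpace ℝ (Fin d)

/-- Values of velocity gradients; the entry `(k, i)` is `∂ₖ uᵢ`, the norm is the Frobenius norm. -/
abbrev Mat (d : ℕ) := EuclideanSpace ℝ (Fin d × Fin d)

/-- The Lebesgue space `[L²(Ω)]^d`. -/
noncomputable abbrev L2Vec {d : ℕ} (Ω : Set (Vec d)) := Lp (Vec d) 2 (volume.restrict Ω)

/-- The Lebesgue space `[L²(Ω)]^{d × d}`. -/
noncomputable abbrev L2Mat {d : ℕ} (Ω : Set (Vec d)) := Lp (Mat d) 2 (volume.restrict Ω)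

/-- The Lebesgue space `L²(Ω)`. -/
noncomputable abbrev L2Scal {d : ℕ} (Ω : Set (Vec d)) := Lp ℝ 2 (volume.restrict Ω)

/-- `φ` is an infinitely differentiable function with compact support inside `Ω`. -/
def IsTestFun {d : ℕ} {F : Type*} [NormedAddCommGroup F] [NormedSpace ℝ F]
    (Ω : Set (Vec d)) (φ : Vec d → F) : Prop :=
  ContDiff ℝ ∞ φ ∧ HasCompactSupport φ ∧ tsupport φ ⊆ Ω

/-- The `k`-th partial derivative. -/
noncomputable def partialDeriv {d : ℕ} {F : Type*} [NormedAddCommGroup F] [NormedSpace ℝ F]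
    (k : Fin d) (φ : Vec d → F) (x : Vec d) : F :=
  fderiv ℝ φ x (EuclideanSpace.single k (1 : ℝ))

/-- The pointwise gradient of a differentiable vector field. -/
noncomputable def classicalGrad {d : ℕ} (φ : Vec d → Vec d) (x : Vec d) : Mat d :=
  WithLp.toLp 2 (fun p : Fin d × Fin d => partialDeriv p.1 φ x p.2)

/-- `G` is the weak gradient of `u` on `Ω`. -/
def IsWeakGrad {d : ℕ} {Ω : Set (Vec d)} (u : L2Vec Ω) (G : L2Mat Ω) : Prop :=
  ∀ ψ : Vec d → ℝ, IsTestFun Ω ψ → ∀ k i : Fin d,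
    ∫ x in Ω, u x i * partialDeriv k ψ x = - ∫ x in Ω, G x (k, i) * ψ x

theorem integrable_coord_mul {d : ℕ} {ι : Type*} [Fintype ι] {Ω : Set (Vec d)}
    (u : Lp (EuclideanSpace ℝ ι) 2 (volume.restrict Ω)) (i : ι) {g : Vec d → ℝ}
    (hg : Continuous g) (hc : HasCompactSupport g) :
    Integrable (fun x => u x i * g x) (volume.restrict Ω) := by
  have h1 : MemLp (fun x => u x i) 2 (volume.restrict Ω) :=
    (EuclideanSpace.proj (𝕜 := ℝ) i).comp_memLp' (Lp.memLp u)
  have h2 : MemLp g 2 (volume.restrict Ω) := hg.memLp_of_hasCompactSupport hc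
  exact h1.integrable_mul h2

theorem IsTestFun.continuous_partialDeriv {d : ℕ} {Ω : Set (Vec d)} {ψ : Vec d → ℝ}
    (h : IsTestFun Ω ψ) (k : Fin d) : Continuous (partialDeriv k ψ) :=
  (h.1.continuous_fderiv (by simp)).clm_apply continuous_const

theorem IsTestFun.compact_partialDeriv {d : ℕ} {Ω : Set (Vec d)} {ψ : Vec d → ℝ}
    (h : IsTestFun Ω ψ) (k : Fin d) : HasCompactSupport (partialDeriv k ψ) :=
  h.2.1.fderiv_apply ℝ _

/-- The Sobolev space `[H¹(Ω)]^d`; an element is a pair `(u, ∇u)` of an `L²` field and its weak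
gradient in `L²` (on an open set the second component is determined by the first one). -/
noncomputable def H1 {d : ℕ} (Ω : Set (Vec d)) : Submodule ℝ (L2Vec Ω × L2Mat Ω) where
  carrier := {p | IsWeakGrad p.1 p.2}
  zero_mem' := by
    intro ψ hψ k i
    have h1 : ∫ x in Ω, (0 : L2Vec Ω) x i * partialDeriv k ψ x = 0 := by
      rw [integral_eq_zero_of_ae]
      filter_upwards [Lp.coeFn_zero (Vec d) 2 (volume.restrict Ω)] with x hx
      rw [hx]
      simp
    have h2 : ∫ x in Ω, (0 : L2Mat Ω) x (k, i) * ψ x = 0 := by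
      rw [integral_eq_zero_of_ae]
      filter_upwards [Lp.coeFn_zero (Mat d) 2 (volume.restrict Ω)] with x hx
      rw [hx]
      simp
    simp only [Prod.fst_zero, Prod.snd_zero, h1, h2, neg_zero]
  add_mem' := by
    intro a b ha hb ψ hψ k i
    have e1 : ∫ x in Ω, (a + b).1 x i * partialDeriv k ψ x
        = ∫ x in Ω, (a.1 x i * partialDeriv k ψ x + b.1 x i * partialDeriv k ψ x) := by
      apply integral_congr_ae
      filter_upwards [Lp.coeFn_add a.1 b.1] with x hx
      rw [Prod.fst_add, hx, Pi.add_apply, PiLp.add_apply, add_mul]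
    have e2 : ∫ x in Ω, (a + b).2 x (k, i) * ψ x
        = ∫ x in Ω, (a.2 x (k, i) * ψ x + b.2 x (k, i) * ψ x) := by
      apply integral_congr_ae
      filter_upwards [Lp.coeFn_add a.2 b.2] with x hx
      rw [Prod.snd_add, hx, Pi.add_apply, PiLp.add_apply, add_mul]
    have c1 := hψ.continuous_partialDeriv k
    have c2 := hψ.compact_partialDeriv k
    rw [e1, e2, integral_add (integrable_coord_mul _ _ c1 c2) (integrable_coord_mul _ _ c1 c2),
      integral_add (integrable_coord_mul _ _ hψ.1.continuous hψ.2.1)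
        (integrable_coord_mul _ _ hψ.1.continuous hψ.2.1), ha ψ hψ k i, hb ψ hψ k i]
    ring
  smul_mem' := by
    intro c a ha ψ hψ k i
    have e1 : ∫ x in Ω, (c • a).1 x i * partialDeriv k ψ x
        = ∫ x in Ω, c * (a.1 x i * partialDeriv k ψ x) := by
      apply integral_congr_ae
      filter_upwards [Lp.coeFn_smul c a.1] with x hx
      rw [Prod.smul_fst, hx, Pi.smul_apply, PiLp.smul_apply, smul_eq_mul, mul_assoc]
    have e2 : ∫ x in Ω, (c • a).2 x (k, i) * ψ x
        = ∫ x in Ω, c * (a.2 x (k, i) * ψ x) := by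
      apply integral_congr_ae
      filter_upwards [Lp.coeFn_smul c a.2] with x hx
      rw [Prod.smul_snd, hx, Pi.smul_apply, PiLp.smul_apply, smul_eq_mul, mul_assoc]
    rw [e1, e2, integral_const_mul, integral_const_mul, ha ψ hψ k i]
    ring

/-- The pairs `(φ, ∇φ)` for the test fields `φ ∈ [C_c^∞(Ω)]^d`. -/
def testPairs {d : ℕ} (Ω : Set (Vec d)) : Set (L2Vec Ω × L2Mat Ω) :=
  {p | ∃ φ : Vec d → Vec d, IsTestFun Ω φ ∧
    (∀ᵐ x ∂(volume.restrict Ω), p.1 x = φ x) ∧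
    (∀ᵐ x ∂(volume.restrict Ω), p.2 x = classicalGrad φ x)}

/-- The velocity space `X = [H¹₀(Ω)]^d`, the elements of `[H¹(Ω)]^d` that lie in the closure of
the test fields. (The product carries the topology of the `H¹` norm.) -/
noncomputable def X {d : ℕ} (Ω : Set (Vec d)) : Submodule ℝ (L2Vec Ω × L2Mat Ω) :=
  H1 Ω ⊓ (Submodule.span ℝ (testPairs Ω)).topologicalClosure

section Forms

variable {d : ℕ} {Ω : Set (Vec d)}

/-- The underlying `L²` field of `u ∈ X`. -/
noncomputable def fn (u : X Ω) : L2Vec Ω := u.1.1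

/-- The gradient of `u ∈ X`. -/
noncomputable def grad (u : X Ω) : L2Mat Ω := u.1.2

/-- The norm `‖f‖₋₁ = sup_{0 ≠ v ∈ X} (f, v) / ‖∇v‖` on the dual `H⁻¹` of `X`. -/
noncomputable def dualNorm (f : StrongDual ℝ (X Ω)) : ℝ :=
  sSup {r : ℝ | ∃ v : X Ω, v ≠ 0 ∧ r = f v / ‖grad v‖}

/-- The trilinear form `(w · ∇u, v)`. -/
noncomputable def convForm (w u v : X Ω) : ℝ :=
  ∫ x in Ω, ∑ k : Fin d, ∑ i : Fin d, fn w x k * grad u x (k, i) * fn v x i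

/-- The explicitly skew-symmetric form `b*(w, u, v) = (w · ∇u, v) / 2 - (w · ∇v, u) / 2`. -/
noncomputable def bStar (w u v : X Ω) : ℝ :=
  1 / 2 * convForm w u v - 1 / 2 * convForm w v u

/-- `C` is an admissible constant in the two standard bounds for `b*` on `X`. -/
def IsTrilinearConst (Ω : Set (Vec d)) (C : ℝ) : Prop :=
  (∀ u v w : X Ω, bStar w u v ≤
    C * ‖grad w‖ * ‖grad u‖ * Real.sqrt (‖fn v‖ * ‖grad v‖)) ∧
  (∀ u v w : X Ω, bStar w u v ≤
    C * Real.sqrt (‖fn w‖ * ‖grad w‖) * ‖grad u‖ * ‖grad v‖)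

/-- The pressure space `Q = L²₀(Ω)` of the `L²` functions with mean zero. -/
def pressureSpace (Ω : Set (Vec d)) : Set (L2Scal Ω) := {q | ∫ x in Ω, q x = 0}

/-- `v` belongs to the discretely divergence-free space
`V_h = {v ∈ X_h : (∇ · v, q) = 0 for all q ∈ Q_h}`. -/
def IsDiscretelyDivFree (Xh : Submodule ℝ (X Ω)) (Qh : Submodule ℝ (L2Scal Ω)) (v : X Ω) : Prop :=
  v ∈ Xh ∧ ∀ q ∈ Qh, ∫ x in Ω, (∑ k : Fin d, grad v x (k, k)) * q x = 0

/-- `φ₁, …, φ_R` is orthonormal in `[L²(Ω)]^d`. -/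
def IsL2Orthonormal {R : ℕ} (φ : Fin R → X Ω) : Prop :=
  Orthonormal ℝ (fun i => fn (φ i))

/-- The sum over the snapshots of the squared `L²` errors `‖s - ∑ᵢ (s, φᵢ) φᵢ‖²`. -/
noncomputable def podError {JS NS R : ℕ} (s : Fin JS → Fin (NS + 1) → X Ω)
    (φ : Fin R → X Ω) : ℝ :=
  ∑ k, ∑ l, ‖fn (s k l) - ∑ i, (inner ℝ (fn (s k l)) (fn (φ i)) : ℝ) • fn (φ i)‖ ^ 2

/-- The space spanned by the snapshots. -/
noncomputable def snapshotSpace {JS NS : ℕ} (s : Fin JS → Fin (NS + 1) → X Ω) : Submodule ℝ (X Ω) :=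
  Submodule.span ℝ {v | ∃ k l, v = s k l}

/-- `φ` is a POD basis of the snapshots `s`: an `L²`-orthonormal family in the span of the
snapshots that minimizes the projection error among all such families. -/
def IsPODBasis {JS NS R : ℕ} (s : Fin JS → Fin (NS + 1) → X Ω) (φ : Fin R → X Ω) : Prop :=
  (∀ i, φ i ∈ snapshotSpace s) ∧ IsL2Orthonormal φ ∧
    ∀ ψ : Fin R → X Ω, (∀ i, ψ i ∈ snapshotSpace s) → IsL2Orthonormal ψ →
      podError s φ ≤ podError s ψ

/-- The POD space `X_R = span {φ₁, …, φ_R}`. -/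
noncomputable def podSpace {R : ℕ} (φ : Fin R → X Ω) : Submodule ℝ (X Ω) :=
  Submodule.span ℝ (Set.range φ)

/-- The POD stiffness matrix, with entries `(∇φᵢ, ∇φⱼ)`. -/
noncomputable def stiffness {R : ℕ} (φ : Fin R → X Ω) : Matrix (Fin R) (Fin R) ℝ :=
  Matrix.of fun i j => (inner ℝ (grad (φ i)) (grad (φ j)) : ℝ)

/-- The matrix 2-norm, i.e. the operator norm for the Euclidean norm. -/
noncomputable def matrixTwoNorm {R : ℕ} (A : Matrix (Fin R) (Fin R) ℝ) : ℝ :=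
  ‖Matrix.toEuclideanCLM (n := Fin R) (𝕜 := ℝ) A‖

/-- `w` is the ROM differential filter of `v` in the space `W`, with filtering radius `δ`. -/
def IsROMFilter (δ : ℝ) (W : Submodule ℝ (X Ω)) (v w : X Ω) : Prop :=
  w ∈ W ∧ ∀ φ ∈ W, δ ^ 2 * (inner ℝ (grad w) (grad φ) : ℝ) + inner ℝ (fn w) (fn φ)
    = inner ℝ (fn v) (fn φ)

theorem existsUnique_of_gram {V A B : Type*} [AddCommGroup V] [Module ℝ V]
    [FiniteDimensional ℝ V] [NormedAddCommGroup A] [InnerProductSpace ℝ A]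
    [NormedAddCommGroup B] [InnerProductSpace ℝ B] {δ : ℝ} (hδ : 0 < δ)
    (g : V →ₗ[ℝ] A) (h : V →ₗ[ℝ] B) (hgh : ∀ w, h w = 0 → g w = 0 → w = 0) (b : B) :
    ∃! w : V, ∀ φ : V, δ ^ 2 * (inner ℝ (g w) (g φ) : ℝ) + inner ℝ (h w) (h φ)
      = inner ℝ b (h φ) := by
  let T : V →ₗ[ℝ] Module.Dual ℝ V :=
    δ ^ 2 • (innerₗ A).compl₁₂ g g + (innerₗ B).compl₁₂ h h
  have hT : ∀ w φ, T w φ = δ ^ 2 * (inner ℝ (g w) (g φ) : ℝ) + inner ℝ (h w) (h φ) :=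
    fun _ _ => rfl
  have hinj : Function.Injective T := by
    rw [← LinearMap.ker_eq_bot, LinearMap.ker_eq_bot']
    intro w hw
    have e := hT w w
    rw [hw, LinearMap.zero_apply, real_inner_self_eq_norm_sq, real_inner_self_eq_norm_sq] at e
    have p1 : 0 < δ ^ 2 := by positivity
    have p2 : 0 ≤ δ ^ 2 * ‖g w‖ ^ 2 := by positivity
    have p3 : 0 ≤ ‖h w‖ ^ 2 := by positivity
    have h1 : ‖h w‖ ^ 2 = 0 := by linarith
    have h2 : δ ^ 2 * ‖g w‖ ^ 2 = 0 := by linarith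
    have h3 : ‖g w‖ ^ 2 = 0 := (mul_eq_zero.1 h2).resolve_left p1.ne'
    exact hgh w (norm_eq_zero.1 (pow_eq_zero_iff two_ne_zero |>.1 h1))
      (norm_eq_zero.1 (pow_eq_zero_iff two_ne_zero |>.1 h3))
  have hsurj : Function.Surjective T :=
    (LinearMap.injective_iff_surjective_of_finrank_eq_finrank
      (Subspace.dual_finrank_eq (K := ℝ) (V := V)).symm).1 hinj
  obtain ⟨w, hw⟩ := hsurj ((innerₗ B b).comp h)
  refine ⟨w, fun φ => ?_, fun w' h' => hinj ?_⟩
  · rw [← hT, hw]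
    rfl
  · rw [hw]
    ext φ
    exact h' φ

theorem existsUnique_romFilter {δ : ℝ} (hδ : 0 < δ) (W : Submodule ℝ (X Ω))
    [FiniteDimensional ℝ W] (v : X Ω) : ∃! w, IsROMFilter δ W v w := by
  let g : W →ₗ[ℝ] L2Mat Ω := (LinearMap.snd ℝ _ _).comp ((X Ω).subtype.comp W.subtype)
  let h : W →ₗ[ℝ] L2Vec Ω := (LinearMap.fst ℝ _ _).comp ((X Ω).subtype.comp W.subtype)
  have hgh : ∀ w : W, h w = 0 → g w = 0 → w = 0 := by
    intro w h1 h2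
    apply Subtype.ext
    apply Subtype.ext
    exact Prod.ext h1 h2
  obtain ⟨w, hw, hu⟩ := existsUnique_of_gram (V := W) (A := L2Mat Ω) (B := L2Vec Ω) hδ g h hgh (fn v)
  refine ⟨w.1, ⟨w.2, fun φ hφ => hw ⟨φ, hφ⟩⟩, ?_⟩
  rintro w' ⟨hw', h'⟩
  exact congrArg Subtype.val (hu ⟨w', hw'⟩ fun φ => h' φ.1 φ.2)

/-- The ROM differential filter of `v`, i.e. the unique `w` with `IsROMFilter δ W v w`. -/
noncomputable def romFilter (δ : ℝ) (W : Submodule ℝ (X Ω)) (v : X Ω) : X Ω :=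
  Classical.epsilon (IsROMFilter δ W v)

theorem romFilter_spec {δ : ℝ} (hδ : 0 < δ) (W : Submodule ℝ (X Ω))
    [FiniteDimensional ℝ W] (v : X Ω) : IsROMFilter δ W v (romFilter δ W v) :=
  Classical.epsilon_spec (existsUnique_romFilter hδ W v).exists

/-- The ensemble mean at time level `n`. -/
noncomputable def ensMean {J : ℕ} (u : Fin J → ℕ → X Ω) (n : ℕ) : X Ω :=
  (1 / (J : ℝ)) • ∑ j, u j n

/-- The fields `u j n`, `0 ≤ n ≤ N`, in `XR` solve the Leray ensemble-POD scheme with time step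
`Δt`, filtering radius `δ`, viscosities `ν j`, implicit viscosity `νmax` and forces `f j n`. -/
def IsLerayEnsemblePOD {J : ℕ} (XR : Submodule ℝ (X Ω)) (δ Δt νmax : ℝ) (ν : Fin J → ℝ)
    (f : Fin J → ℕ → StrongDual ℝ (X Ω)) (N : ℕ) (u : Fin J → ℕ → X Ω) : Prop :=
  (∀ j, ∀ n ≤ N, u j n ∈ XR) ∧
  ∀ j, ∀ n < N, ∀ φ ∈ XR,
    (inner ℝ ((1 / Δt) • (fn (u j (n + 1)) - fn (u j n))) (fn φ) : ℝ)
      + bStar (romFilter δ XR (ensMean u n)) (u j (n + 1)) φ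
      + bStar (romFilter δ XR (u j n - ensMean u n)) (u j n) φ
      + νmax * (inner ℝ (grad (u j (n + 1))) (grad φ) : ℝ)
      + (ν j - νmax) * (inner ℝ (grad (u j n)) (grad φ) : ℝ)
      = f j (n + 1) φ

end Forms

end LerayPOD

open LerayPOD

/-! Stability is an energy argument. When the scheme is tested with $u^{n+1}$, the implicit
convective term vanishes by skew-symmetry, and the lagged one, with $w$ the filtered fluctuation,
equals $b^*(w,u^n,u^{n+1}-u^n)$ up to an added multiple of $b^*(w,u^n,u^n)=0$. The first bound in
(1) and the inverse inequality $\|\nabla v\|^2\le|||\mathbb S_R|||_2\|v\|^2$ on $X_R$ control it by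
$\|\nabla w\|\,\|\nabla u^n\|\,\|u^{n+1}-u^n\|$. Under the time-step condition, Young's inequality
absorbs this into the numerical dissipation $\|u^{n+1}-u^n\|^2/(2\Delta t)$ and a share $\epsilon$
of the viscosity (`neg_bStar_le`). The explicit viscous term costs the share $1-\epsilon$; what is
left pays for the force and for the dissipation in the conclusion (`energy_step`). The steps then
telescope.

The analytic input is the embedding of $X$ into $L^6$ for $d\in\{2,3\}$ (`exists_sobolev`), obtained
for test fields and passed to their closure. With Hölder's inequality it makes every convective
integral finite, so that $b^*$ is additive in its arguments, and gives the existence of $C_{b^*}$.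
The first bound in (1) also needs an integration by parts (`tri_product_rule`), proved for test
fields and extended by density. The embedding also yields the Poincaré inequality, which makes the
dual norm a genuine supremum. -/

namespace LerayPOD

open Filter Topology
open scoped ENNReal NNReal

/-! ### Sobolev and Poincaré inequalities on the closure of the test fields. -/

section SobolevEmbedding

variable {d : ℕ} {Ω : Set (Vec d)}

theorem partialDeriv_apply_coord {φ : Vec d → Vec d} {x : Vec d} (h : DifferentiableAt ℝ φ x)
    (k i : Fin d) : partialDeriv k (fun y => φ y i) x = partialDeriv k φ x i := by
  have h1 : HasFDerivAt (fun y => φ y i)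
      ((EuclideanSpace.proj (𝕜 := ℝ) i).comp (fderiv ℝ φ x)) x :=
    (EuclideanSpace.proj (𝕜 := ℝ) i).hasFDerivAt.comp x h.hasFDerivAt
  simp [partialDeriv, h1.fderiv]

theorem IsTestFun.coord {φ : Vec d → Vec d} (h : IsTestFun Ω φ) (i : Fin d) :
    IsTestFun Ω (fun y => φ y i) := by
  have hs : tsupport (fun y => φ y i) ⊆ tsupport φ :=
    tsupport_comp_subset (g := fun z : Vec d => z i) rfl φ
  exact ⟨(EuclideanSpace.proj (𝕜 := ℝ) i).contDiff.comp h.1,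
    HasCompactSupport.mono' h.2.1 ((subset_tsupport _).trans hs), hs.trans h.2.2⟩

theorem IsTestFun.differentiable {F : Type*} [NormedAddCommGroup F] [NormedSpace ℝ F]
    {φ : Vec d → F} (h : IsTestFun Ω φ) : Differentiable ℝ φ :=
  h.1.differentiable (by simp)

theorem IsTestFun.add {F : Type*} [NormedAddCommGroup F] [NormedSpace ℝ F]
    {φ ψ : Vec d → F} (h : IsTestFun Ω φ) (h' : IsTestFun Ω ψ) : IsTestFun Ω (φ + ψ) :=
  ⟨h.1.add h'.1, h.2.1.add h'.2.1,
    (tsupport_add φ ψ).trans (Set.union_subset h.2.2 h'.2.2)⟩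

theorem IsTestFun.const_smul {F : Type*} [NormedAddCommGroup F] [NormedSpace ℝ F]
    {φ : Vec d → F} (c : ℝ) (h : IsTestFun Ω φ) : IsTestFun Ω (c • φ) := by
  have hs : tsupport (c • φ) ⊆ tsupport φ :=
    tsupport_comp_subset (g := fun z : F => c • z) (smul_zero c) φ
  exact ⟨h.1.const_smul c,
    HasCompactSupport.mono' h.2.1 ((subset_tsupport _).trans hs), hs.trans h.2.2⟩

/-- The test pairs form a linear subspace. -/
def testSubmodule (Ω : Set (Vec d)) : Submodule ℝ (L2Vec Ω × L2Mat Ω) where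
  carrier := testPairs Ω
  zero_mem' := by
    refine ⟨0, ⟨contDiff_const, HasCompactSupport.zero, by simp [tsupport]⟩, ?_, ?_⟩
    · filter_upwards [Lp.coeFn_zero (Vec d) 2 (volume.restrict Ω)] with x hx
      exact hx
    · filter_upwards [Lp.coeFn_zero (Mat d) 2 (volume.restrict Ω)] with x hx
      refine hx.trans ?_
      ext p
      simp [classicalGrad, partialDeriv]
  add_mem' := by
    rintro a b ⟨φ, hφ, h1, h2⟩ ⟨ψ, hψ, h3, h4⟩
    refine ⟨φ + ψ, hφ.add hψ, ?_, ?_⟩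
    · filter_upwards [Lp.coeFn_add a.1 b.1, h1, h3] with x hx e1 e2
      rw [Prod.fst_add, hx, Pi.add_apply, e1, e2, Pi.add_apply]
    · filter_upwards [Lp.coeFn_add a.2 b.2, h2, h4] with x hx e1 e2
      rw [Prod.snd_add, hx, Pi.add_apply, e1, e2]
      ext p
      simp [classicalGrad, partialDeriv, fderiv_add hφ.differentiable.differentiableAt
        hψ.differentiable.differentiableAt]
  smul_mem' := by
    rintro c a ⟨φ, hφ, h1, h2⟩
    refine ⟨c • φ, hφ.const_smul c, ?_, ?_⟩
    · filter_upwards [Lp.coeFn_smul c a.1, h1] with x hx e1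
      rw [Prod.smul_fst, hx, Pi.smul_apply, e1, Pi.smul_apply]
    · filter_upwards [Lp.coeFn_smul c a.2, h2] with x hx e1
      rw [Prod.smul_snd, hx, Pi.smul_apply, e1]
      ext p
      simp [classicalGrad, partialDeriv, fderiv_const_smul hφ.differentiable.differentiableAt]

/-- The closure of the test pairs, which contains `X Ω`. -/
noncomputable def testClosure (Ω : Set (Vec d)) : Submodule ℝ (L2Vec Ω × L2Mat Ω) :=
  (testSubmodule Ω).topologicalClosure

/-- The test pairs are already a subspace, so the span in `X` adds nothing and every element of `X
Ω` is the limit of a sequence of actual test pairs. All density arguments rest on this. -/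
theorem X_le_testClosure : X Ω ≤ testClosure Ω := by
  refine inf_le_right.trans (Submodule.topologicalClosure_mono ?_)
  exact Submodule.span_le.2 fun _ h => h

theorem norm_fderiv_le_classicalGrad {φ : Vec d → Vec d} {x : Vec d} :
    ‖fderiv ℝ φ x‖ ≤ d * ‖classicalGrad φ x‖ := by
  refine ContinuousLinearMap.opNorm_le_bound _ (by positivity) fun y => ?_
  have hk : ∀ k : Fin d, ‖partialDeriv k φ x‖ ≤ ‖classicalGrad φ x‖ := by
    intro k
    rw [EuclideanSpace.norm_eq, EuclideanSpace.norm_eq]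
    apply Real.sqrt_le_sqrt
    rw [Fintype.sum_prod_type]
    exact Finset.single_le_sum (f := fun k => ∑ i, ‖classicalGrad φ x (k, i)‖ ^ 2)
      (fun k _ => by positivity) (Finset.mem_univ k)
  have hy : y = ∑ k, y k • EuclideanSpace.single k (1 : ℝ) := by
    ext i
    simp [Finset.sum_apply, Pi.single_apply]
  calc ‖fderiv ℝ φ x y‖ = ‖∑ k, y k • partialDeriv k φ x‖ := by
        conv_lhs => rw [hy]
        simp [partialDeriv]
    _ ≤ ∑ k, ‖y k • partialDeriv k φ x‖ := norm_sum_le _ _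
    _ ≤ ∑ _k : Fin d, ‖y‖ * ‖classicalGrad φ x‖ := by
        refine Finset.sum_le_sum fun k _ => ?_
        rw [norm_smul]
        exact mul_le_mul (PiLp.norm_apply_le y k) (hk k) (norm_nonneg _) (norm_nonneg _)
    _ = d * ‖classicalGrad φ x‖ * ‖y‖ := by simp; ring

/-- Gagliardo–Nirenberg–Sobolev for fields supported in Ω, with some exponent $p\le2$ on the
gradient, followed by Hölder from $L^2$ to $L^p$ on the bounded set Ω. No regularity of the boundary
enters. -/
theorem exists_sobolev_testFun (hd : d = 2 ∨ d = 3) (hΩb : Bornology.IsBounded Ω)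
    (hΩ : MeasurableSet Ω) :
    ∃ C : ℝ≥0, ∀ φ : Vec d → Vec d, IsTestFun Ω φ →
      eLpNorm φ 6 (volume.restrict Ω)
        ≤ C * eLpNorm (classicalGrad φ) 2 (volume.restrict Ω) := by
  -- The Sobolev conjugate of $p$ is exactly 6 in both cases: $2/3-1/2=1/6$ for $d=2$ and
  -- $1/2-1/3=1/6$ for $d=3$. In the plane $p=2$ is excluded by $p<d$.
  obtain ⟨p, hp1, hpd, hp2, hp6⟩ : ∃ p : ℝ≥0, 1 ≤ p ∧ p < d ∧ p ≤ 2 ∧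
      (p : ℝ)⁻¹ - (d : ℝ)⁻¹ ≤ ((6 : ℝ≥0) : ℝ)⁻¹ := by
    rcases hd with rfl | rfl
    · refine ⟨3 / 2, ?_, ?_, ?_, ?_⟩ <;>
        first
        | (rw [← NNReal.coe_le_coe]; push_cast; norm_num)
        | (rw [← NNReal.coe_lt_coe]; push_cast; norm_num)
        | (push_cast; norm_num)
    · refine ⟨2, ?_, ?_, ?_, ?_⟩ <;>
        first
        | (rw [← NNReal.coe_le_coe]; push_cast; norm_num)
        | (rw [← NNReal.coe_lt_coe]; push_cast; norm_num)
        | (push_cast; norm_num)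
  have hfin : volume Ω ≠ ⊤ := hΩb.measure_lt_top.ne
  have hp2' : (p : ℝ≥0∞) ≤ 2 := by exact_mod_cast hp2
  set C₀ := eLpNormLESNormFDerivOfLeConst (Vec d) (volume : Measure (Vec d)) Ω p 6
  set e : ℝ := 1 / (p : ℝ≥0∞).toReal - 1 / (2 : ℝ≥0∞).toReal
  have he : 0 ≤ e := by
    have : (1 : ℝ) ≤ p := by exact_mod_cast hp1
    have h2 : (p : ℝ) ≤ 2 := by exact_mod_cast hp2
    simp only [e, ENNReal.coe_toReal, ENNReal.toReal_ofNat, sub_nonneg]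
    gcongr
  have hm : volume Ω ^ e ≠ ⊤ := ENNReal.rpow_ne_top_of_nonneg he hfin
  refine ⟨C₀ * (d * (volume Ω ^ e).toNNReal), fun φ hφ => ?_⟩
  have hsupp : φ.support ⊆ Ω := (subset_tsupport φ).trans hφ.2.2
  have h1 := eLpNorm_le_eLpNorm_fderiv_of_le (volume : Measure (Vec d)) (u := φ) (s := Ω) (p := p)
    (q := 6) (hφ.1.of_le (by simp)) hsupp hp1
    (by rw [finrank_euclideanSpace_fin]; exact hpd)
    (by rw [finrank_euclideanSpace_fin]; exact hp6) hΩb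
  have hsupp' : (fderiv ℝ φ).support ⊆ Ω := (support_fderiv_subset ℝ).trans hφ.2.2
  have h2 : eLpNorm (fderiv ℝ φ) p volume = eLpNorm (fderiv ℝ φ) p (volume.restrict Ω) := by
    have := eLpNorm_indicator_eq_eLpNorm_restrict (μ := volume) (f := fderiv ℝ φ) (p := p) hΩ
    rwa [Set.indicator_eq_self.2 hsupp'] at this
  have h3 : eLpNorm (fderiv ℝ φ) p (volume.restrict Ω)
      ≤ eLpNorm (fderiv ℝ φ) 2 (volume.restrict Ω) * volume Ω ^ e := by
    have := eLpNorm_le_eLpNorm_mul_rpow_measure_univ hp2' (μ := volume.restrict Ω)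
      (f := fderiv ℝ φ) ((hφ.1.continuous_fderiv (by simp)).aestronglyMeasurable)
    rwa [Measure.restrict_apply_univ] at this
  have h4 : eLpNorm (fderiv ℝ φ) 2 (volume.restrict Ω)
      ≤ d * eLpNorm (classicalGrad φ) 2 (volume.restrict Ω) := by
    have := eLpNorm_le_mul_eLpNorm_of_ae_le_mul (μ := volume.restrict Ω) (p := 2)
      (f := fderiv ℝ φ) (g := classicalGrad φ) (c := (d : ℝ))
      (Eventually.of_forall fun x => norm_fderiv_le_classicalGrad)
    simpa using this
  calc eLpNorm φ 6 (volume.restrict Ω) ≤ eLpNorm φ 6 volume :=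
        eLpNorm_mono_measure _ Measure.restrict_le_self
    _ ≤ C₀ * eLpNorm (fderiv ℝ φ) p volume := by exact_mod_cast h1
    _ ≤ C₀ * ((d * eLpNorm (classicalGrad φ) 2 (volume.restrict Ω)) * volume Ω ^ e) := by
        rw [h2]
        gcongr
        exact h3.trans (by gcongr)
    _ = _ := by
        push_cast
        rw [ENNReal.coe_toNNReal hm]
        ring

theorem exists_seq_testPairs {p : L2Vec Ω × L2Mat Ω} (hp : p ∈ testClosure Ω) :
    ∃ a : ℕ → L2Vec Ω × L2Mat Ω, (∀ n, a n ∈ testPairs Ω) ∧ Tendsto a atTop (𝓝 p) := by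
  have : p ∈ closure (testSubmodule Ω : Set (L2Vec Ω × L2Mat Ω)) := hp
  exact mem_closure_iff_seq_limit.1 this

/-- The Sobolev embedding `‖u‖_{L⁶} ≤ C ‖∇u‖_{L²}` in dimensions two and three. -/
theorem exists_sobolev (hd : d = 2 ∨ d = 3) (hΩb : Bornology.IsBounded Ω)
    (hΩ : MeasurableSet Ω) :
    ∃ C : ℝ≥0, ∀ p ∈ testClosure Ω, eLpNorm p.1 6 (volume.restrict Ω) ≤ C * ‖p.2‖ₑ := by
  obtain ⟨C, hC⟩ := exists_sobolev_testFun hd hΩb hΩ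
  refine ⟨C, fun p hp => ?_⟩
  obtain ⟨a, ha, hlim⟩ := exists_seq_testPairs hp
  have hbound : ∀ n, eLpNorm (a n).1 6 (volume.restrict Ω) ≤ C * ‖(a n).2‖ₑ := by
    intro n
    obtain ⟨φ, hφ, h1, h2⟩ := ha n
    rw [eLpNorm_congr_ae h1, Lp.enorm_def, eLpNorm_congr_ae h2]
    exact hC φ hφ
  have h1 : Tendsto (fun n => (a n).1) atTop (𝓝 p.1) := (continuous_fst.tendsto p).comp hlim
  -- The sequence converges only in $L^2$, so the $L^6$ bound is passed to the limit by Fatou's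
  -- lemma along an almost everywhere convergent subsequence.
  obtain ⟨ns, hns, hae⟩ := (tendstoInMeasure_of_tendsto_Lp h1).exists_seq_tendsto_ae
  have h2 : Tendsto (fun n => (C : ℝ≥0∞) * ‖(a (ns n)).2‖ₑ) atTop (𝓝 (C * ‖p.2‖ₑ)) := by
    refine ENNReal.Tendsto.const_mul ?_ (Or.inr ENNReal.coe_ne_top)
    exact ((continuous_enorm.comp continuous_snd).tendsto p).comp (hlim.comp hns.tendsto_atTop)
  calc eLpNorm p.1 6 (volume.restrict Ω)
      ≤ liminf (fun n => eLpNorm (a (ns n)).1 6 (volume.restrict Ω)) atTop :=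
        Lp.eLpNorm_lim_le_liminf_eLpNorm (fun n => Lp.aestronglyMeasurable _) _ hae
    _ ≤ liminf (fun n => (C : ℝ≥0∞) * ‖(a (ns n)).2‖ₑ) atTop :=
        liminf_le_liminf (Eventually.of_forall fun n => hbound _)
    _ = C * ‖p.2‖ₑ := h2.liminf_eq

/-- The Poincaré inequality. -/
theorem exists_poincare (hd : d = 2 ∨ d = 3) (hΩb : Bornology.IsBounded Ω)
    (hΩ : MeasurableSet Ω) :
    ∃ C : ℝ, 0 ≤ C ∧ ∀ p ∈ testClosure Ω, ‖p.1‖ ≤ C * ‖p.2‖ := by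
  obtain ⟨C, hC⟩ := exists_sobolev hd hΩb hΩ
  have hfin : volume Ω ≠ ⊤ := hΩb.measure_lt_top.ne
  set e : ℝ := 1 / (2 : ℝ≥0∞).toReal - 1 / (6 : ℝ≥0∞).toReal
  have he : 0 ≤ e := by simp only [e]; norm_num
  have hm : volume Ω ^ e ≠ ⊤ := ENNReal.rpow_ne_top_of_nonneg he hfin
  refine ⟨C * (volume Ω ^ e).toReal, by positivity, fun p hp => ?_⟩
  have h := eLpNorm_le_eLpNorm_mul_rpow_measure_univ (p := 2) (q := 6) (by norm_num)
    (μ := volume.restrict Ω) (f := p.1) (Lp.aestronglyMeasurable _)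
  rw [Measure.restrict_apply_univ] at h
  have h' : ‖p.1‖ₑ ≤ C * ‖p.2‖ₑ * volume Ω ^ e := by
    rw [Lp.enorm_def]
    exact h.trans (by gcongr; exact hC p hp)
  have h'' := ENNReal.toReal_mono (by finiteness) h'
  simp only [ENNReal.toReal_mul, toReal_enorm, ENNReal.coe_toReal] at h''
  linarith

end SobolevEmbedding

end LerayPOD

namespace LerayPOD

open Filter Topology
open scoped ENNReal NNReal

/-! ### Estimates, integration by parts and skew-symmetry for the convective form. -/

section TrilinearForm

theorem lintegral_mul_mul_le {α : Type*} [MeasurableSpace α] {μ : Measure α} {a b c : α → ℝ}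
    (ha : AEStronglyMeasurable a μ) (hb : AEStronglyMeasurable b μ)
    (hc : AEStronglyMeasurable c μ) :
    ∫⁻ x, ‖a x * b x * c x‖ₑ ∂μ ≤ eLpNorm a 6 μ * eLpNorm b 2 μ *
      (eLpNorm c 2 μ * eLpNorm c 6 μ) ^ (1 / 2 : ℝ) := by
  have key := ENNReal.lintegral_prod_norm_pow_le (μ := μ) (Finset.univ : Finset (Fin 4))
    (f := ![fun x => ‖a x‖ₑ ^ (6 : ℝ), fun x => ‖b x‖ₑ ^ (2 : ℝ), fun x => ‖c x‖ₑ ^ (2 : ℝ),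
      fun x => ‖c x‖ₑ ^ (6 : ℝ)])
    (by
      intro i _
      fin_cases i
      · exact ha.enorm.pow_const _
      · exact hb.enorm.pow_const _
      · exact hc.enorm.pow_const _
      · exact hc.enorm.pow_const _)
    -- The weights sum to 1. The factor $|c|$ is split as $(|c|^2)^{1/4}(|c|^6)^{1/12}$, which
    -- builds the interpolation of $L^3$ between $L^2$ and $L^6$ into a single Hölder inequality.
    (p := ![1 / 6, 1 / 2, 1 / 4, 1 / 12])
    (by simp [Fin.sum_univ_four]; norm_num)
    (by intro i _; fin_cases i <;> norm_num)
  simp only [Fin.prod_univ_four, Matrix.cons_val_zero, Matrix.cons_val_one,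
    Matrix.cons_val] at key
  have hN : ∀ (g : α → ℝ) (p : ℝ≥0∞), p ≠ 0 → p ≠ ⊤ →
      eLpNorm g p μ = (∫⁻ x, ‖g x‖ₑ ^ p.toReal ∂μ) ^ (1 / p.toReal) :=
    fun g p h0 h1 => eLpNorm_eq_lintegral_rpow_enorm_toReal h0 h1
  rw [hN a 6 (by norm_num) (by norm_num), hN b 2 (by norm_num) (by norm_num),
    hN c 2 (by norm_num) (by norm_num), hN c 6 (by norm_num) (by norm_num)]
  simp only [ENNReal.toReal_ofNat]
  rw [ENNReal.mul_rpow_of_nonneg _ _ (by norm_num : (0 : ℝ) ≤ 1 / 2), ← ENNReal.rpow_mul,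
    ← ENNReal.rpow_mul]
  norm_num only at key ⊢
  rw [← mul_assoc]
  refine le_trans (le_of_eq (lintegral_congr fun x => ?_)) key
  rw [← ENNReal.rpow_mul, ← ENNReal.rpow_mul, ← ENNReal.rpow_mul, ← ENNReal.rpow_mul,
    mul_assoc _ (‖c x‖ₑ ^ _), ← ENNReal.rpow_add_of_nonneg _ _ (by norm_num) (by norm_num)]
  norm_num [enorm_mul]

variable {d : ℕ} {Ω : Set (Vec d)}

/-- The scalar building block `(w_k ∂_l u_m, v_i)` of the convective forms. -/
noncomputable def tri (k l m i : Fin d) (w u v : L2Vec Ω × L2Mat Ω) : ℝ :=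
  ∫ x in Ω, w.1 x k * u.2 x (l, m) * v.1 x i

theorem aestronglyMeasurable_coord {ι : Type*} [Fintype ι]
    (u : Lp (EuclideanSpace ℝ ι) 2 (volume.restrict Ω)) (i : ι) :
    AEStronglyMeasurable (fun x => u x i) (volume.restrict Ω) :=
  (EuclideanSpace.proj (𝕜 := ℝ) i).continuous.comp_aestronglyMeasurable
    (Lp.aestronglyMeasurable u)

theorem eLpNorm_coord_le {ι : Type*} [Fintype ι] (p : ℝ≥0∞)
    (u : Lp (EuclideanSpace ℝ ι) 2 (volume.restrict Ω)) (i : ι) :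
    eLpNorm (fun x => u x i) p (volume.restrict Ω) ≤ eLpNorm u p (volume.restrict Ω) :=
  eLpNorm_mono fun x => PiLp.norm_apply_le (u x) i

/-- The bound `‖u‖_{L⁶} ≤ C ‖∇u‖` on the closure of the test fields. -/
def IsSobolevConst (Ω : Set (Vec d)) (C : ℝ≥0) : Prop :=
  ∀ p ∈ testClosure Ω, eLpNorm p.1 6 (volume.restrict Ω) ≤ C * ‖p.2‖ₑ

theorem lintegral_tri_le {C : ℝ≥0} (hC : IsSobolevConst Ω C) (k l m i : Fin d)
    {w v : L2Vec Ω × L2Mat Ω} (hw : w ∈ testClosure Ω) (u : L2Vec Ω × L2Mat Ω)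
    (hv : v ∈ testClosure Ω) :
    ∫⁻ x in Ω, ‖w.1 x k * u.2 x (l, m) * v.1 x i‖ₑ ≤
      C * ‖w.2‖ₑ * ‖u.2‖ₑ * (‖v.1‖ₑ * (C * ‖v.2‖ₑ)) ^ (1 / 2 : ℝ) := by
  refine (lintegral_mul_mul_le (aestronglyMeasurable_coord w.1 k)
    (aestronglyMeasurable_coord u.2 (l, m)) (aestronglyMeasurable_coord v.1 i)).trans ?_
  gcongr
  · exact (eLpNorm_coord_le 6 w.1 k).trans (hC w hw)
  · exact (eLpNorm_coord_le 2 u.2 (l, m)).trans_eq (Lp.enorm_def _).symm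
  · exact (eLpNorm_coord_le 2 v.1 i).trans_eq (Lp.enorm_def _).symm
  · exact (eLpNorm_coord_le 6 v.1 i).trans (hC v hv)

/-- The Bochner integral of a nonintegrable function is 0 by default, so additivity of the form in
each slot depends on this. -/
theorem tri_integrable {C : ℝ≥0} (hC : IsSobolevConst Ω C) (k l m i : Fin d)
    {w v : L2Vec Ω × L2Mat Ω} (hw : w ∈ testClosure Ω) (u : L2Vec Ω × L2Mat Ω)
    (hv : v ∈ testClosure Ω) :
    Integrable (fun x => w.1 x k * u.2 x (l, m) * v.1 x i) (volume.restrict Ω) := by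
  refine ⟨((aestronglyMeasurable_coord w.1 k).mul
    (aestronglyMeasurable_coord u.2 (l, m))).mul (aestronglyMeasurable_coord v.1 i), ?_⟩
  refine (lintegral_tri_le hC k l m i hw u hv).trans_lt ?_
  have : (‖v.1‖ₑ * (C * ‖v.2‖ₑ)) ^ (1 / 2 : ℝ) ≠ ⊤ :=
    ENNReal.rpow_ne_top_of_nonneg (by norm_num) (by finiteness)
  exact ENNReal.mul_lt_top (by finiteness) this.lt_top

theorem abs_tri_le {C : ℝ≥0} (hC : IsSobolevConst Ω C) (k l m i : Fin d)
    {w v : L2Vec Ω × L2Mat Ω} (hw : w ∈ testClosure Ω) (u : L2Vec Ω × L2Mat Ω)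
    (hv : v ∈ testClosure Ω) :
    |tri k l m i w u v| ≤
      C * √C * ‖w.2‖ * ‖u.2‖ * √(‖v.1‖ * ‖v.2‖) := by
  have h1 := (enorm_integral_le_lintegral_enorm _).trans (lintegral_tri_le hC k l m i hw u hv)
  have hfin : (‖v.1‖ₑ * (C * ‖v.2‖ₑ)) ^ (1 / 2 : ℝ) ≠ ⊤ :=
    ENNReal.rpow_ne_top_of_nonneg (by norm_num) (by finiteness)
  have h2 := ENNReal.toReal_mono (ENNReal.mul_ne_top (by finiteness) hfin) h1
  simp only [ENNReal.toReal_mul, toReal_enorm, ENNReal.coe_toReal, ← ENNReal.toReal_rpow,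
    ← Real.sqrt_eq_rpow] at h2
  rw [Real.norm_eq_abs] at h2
  refine h2.trans (le_of_eq ?_)
  rw [show ‖v.1‖ * ((C : ℝ) * ‖v.2‖) = C * (‖v.1‖ * ‖v.2‖) by ring, Real.sqrt_mul C.coe_nonneg]
  ring

/-- The two undifferentiated fields play the same role, so every estimate or limit in the first slot
transfers to the third. -/
theorem tri_swap (k l m i : Fin d) (w u v : L2Vec Ω × L2Mat Ω) :
    tri k l m i w u v = tri i l m k v u w := by
  unfold tri
  congr 1
  ext x
  ring

theorem tri_sub_left {C : ℝ≥0} (hC : IsSobolevConst Ω C) (k l m i : Fin d)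
    {w w' v : L2Vec Ω × L2Mat Ω} (hw : w ∈ testClosure Ω) (hw' : w' ∈ testClosure Ω)
    (u : L2Vec Ω × L2Mat Ω) (hv : v ∈ testClosure Ω) :
    tri k l m i (w - w') u v = tri k l m i w u v - tri k l m i w' u v := by
  unfold tri
  rw [← integral_sub (tri_integrable hC k l m i hw u hv) (tri_integrable hC k l m i hw' u hv)]
  apply integral_congr_ae
  filter_upwards [Lp.coeFn_sub w.1 w'.1] with x hx
  rw [Prod.fst_sub, hx, Pi.sub_apply, PiLp.sub_apply]
  ring

theorem tri_sub_right {C : ℝ≥0} (hC : IsSobolevConst Ω C) (k l m i : Fin d)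
    {w v v' : L2Vec Ω × L2Mat Ω} (hw : w ∈ testClosure Ω)
    (u : L2Vec Ω × L2Mat Ω) (hv : v ∈ testClosure Ω) (hv' : v' ∈ testClosure Ω) :
    tri k l m i w u (v - v') = tri k l m i w u v - tri k l m i w u v' := by
  rw [tri_swap, tri_sub_left hC _ _ _ _ hv hv' _ hw, tri_swap, tri_swap i l m k v']

theorem tri_sub_mid {C : ℝ≥0} (hC : IsSobolevConst Ω C) (k l m i : Fin d)
    {w v : L2Vec Ω × L2Mat Ω} (hw : w ∈ testClosure Ω)
    (u u' : L2Vec Ω × L2Mat Ω) (hv : v ∈ testClosure Ω) :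
    tri k l m i w (u - u') v = tri k l m i w u v - tri k l m i w u' v := by
  unfold tri
  rw [← integral_sub (tri_integrable hC k l m i hw u hv) (tri_integrable hC k l m i hw u' hv)]
  apply integral_congr_ae
  filter_upwards [Lp.coeFn_sub u.2 u'.2] with x hx
  rw [Prod.snd_sub, hx, Pi.sub_apply, PiLp.sub_apply]
  ring

/-- A coarser bound in the norm of pairs; it gives the separate continuity needed for density
arguments. -/
theorem abs_tri_le_norm {C : ℝ≥0} (hC : IsSobolevConst Ω C) (k l m i : Fin d)
    {w v : L2Vec Ω × L2Mat Ω} (hw : w ∈ testClosure Ω) (u : L2Vec Ω × L2Mat Ω)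
    (hv : v ∈ testClosure Ω) :
    |tri k l m i w u v| ≤ C * √C * ‖w‖ * ‖u‖ * ‖v‖ := by
  refine (abs_tri_le hC k l m i hw u hv).trans ?_
  have h : √(‖v.1‖ * ‖v.2‖) ≤ ‖v‖ := by
    rw [Real.sqrt_le_left (norm_nonneg v), sq]
    exact mul_le_mul (norm_fst_le v) (norm_snd_le v) (norm_nonneg _) (norm_nonneg _)
  have hw' := norm_snd_le w
  have hu' := norm_snd_le u
  gcongr

/-! ### Separate continuity of the trilinear form. -/

section Continuity

variable {C : ℝ≥0} {a : ℕ → L2Vec Ω × L2Mat Ω}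

theorem tendsto_of_abs_sub_le {F : L2Vec Ω × L2Mat Ω → ℝ} {p : L2Vec Ω × L2Mat Ω} {M : ℝ}
    (hlim : Tendsto a atTop (𝓝 p)) (h : ∀ n, |F (a n) - F p| ≤ M * ‖a n - p‖) :
    Tendsto (fun n => F (a n)) atTop (𝓝 (F p)) := by
  rw [tendsto_iff_norm_sub_tendsto_zero] at hlim ⊢
  refine squeeze_zero (fun n => norm_nonneg _) h ?_
  simpa using hlim.const_mul M

theorem tendsto_tri_left (hC : IsSobolevConst Ω C) (k l m i : Fin d)
    {w v : L2Vec Ω × L2Mat Ω} (hw : w ∈ testClosure Ω) (ha : ∀ n, a n ∈ testClosure Ω)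
    (hlim : Tendsto a atTop (𝓝 w)) (u : L2Vec Ω × L2Mat Ω) (hv : v ∈ testClosure Ω) :
    Tendsto (fun n => tri k l m i (a n) u v) atTop (𝓝 (tri k l m i w u v)) := by
  refine tendsto_of_abs_sub_le (F := fun w => tri k l m i w u v)
    (M := C * √C * ‖u‖ * ‖v‖) hlim fun n => ?_
  rw [← tri_sub_left hC k l m i (ha n) hw u hv]
  exact (abs_tri_le_norm hC k l m i (sub_mem (ha n) hw) u hv).trans (le_of_eq (by ring))

theorem tendsto_tri_right (hC : IsSobolevConst Ω C) (k l m i : Fin d)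
    {w v : L2Vec Ω × L2Mat Ω} (hw : w ∈ testClosure Ω) (ha : ∀ n, a n ∈ testClosure Ω)
    (u : L2Vec Ω × L2Mat Ω) (hv : v ∈ testClosure Ω) (hlim : Tendsto a atTop (𝓝 v)) :
    Tendsto (fun n => tri k l m i w u (a n)) atTop (𝓝 (tri k l m i w u v)) := by
  simp_rw [tri_swap k l m i w u]
  exact tendsto_tri_left hC i l m k hv ha hlim u hw

theorem tendsto_tri_mid (hC : IsSobolevConst Ω C) (k l m i : Fin d)
    {w u v : L2Vec Ω × L2Mat Ω} (hw : w ∈ testClosure Ω) (hv : v ∈ testClosure Ω)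
    (hlim : Tendsto a atTop (𝓝 u)) :
    Tendsto (fun n => tri k l m i w (a n) v) atTop (𝓝 (tri k l m i w u v)) := by
  refine tendsto_of_abs_sub_le (F := fun u => tri k l m i w u v)
    (M := C * √C * ‖w‖ * ‖v‖) hlim fun n => ?_
  rw [← tri_sub_mid hC k l m i hw _ _ hv]
  exact (abs_tri_le_norm hC k l m i hw _ hv).trans (le_of_eq (by ring))

end Continuity

/-- The sum is the integral of $\partial_k(fgh)$, which vanishes by compact support. -/
theorem integral_testFun_product_rule {f g h : Vec d → ℝ} (hf : IsTestFun Ω f)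
    (hg : IsTestFun Ω g) (hh : IsTestFun Ω h) (k : Fin d) :
    (∫ x in Ω, f x * partialDeriv k g x * h x) + (∫ x in Ω, f x * partialDeriv k h x * g x)
      + (∫ x in Ω, g x * partialDeriv k f x * h x) = 0 := by
  have cf := hf.1.continuous
  have cg := hg.1.continuous
  have ch := hh.1.continuous
  have cdf := hf.continuous_partialDeriv k
  have cdg := hg.continuous_partialDeriv k
  have cdh := hh.continuous_partialDeriv k
  have i1 : Integrable (fun x => f x * partialDeriv k g x * h x) volume :=
    ((cf.mul cdg).mul ch).integrable_of_hasCompactSupport hh.2.1.mul_left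
  have i2 : Integrable (fun x => f x * partialDeriv k h x * g x) volume :=
    ((cf.mul cdh).mul cg).integrable_of_hasCompactSupport hg.2.1.mul_left
  have i3 : Integrable (fun x => g x * partialDeriv k f x * h x) volume :=
    ((cg.mul cdf).mul ch).integrable_of_hasCompactSupport hh.2.1.mul_left
  have i4 : Integrable (fun x => f x * g x * h x) volume :=
    ((cf.mul cg).mul ch).integrable_of_hasCompactSupport hh.2.1.mul_left
  have hd : ∀ x, fderiv ℝ (fun y => f y * g y) x (EuclideanSpace.single k (1 : ℝ))
      = f x * partialDeriv k g x + g x * partialDeriv k f x := by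
    intro x
    rw [fderiv_fun_mul hf.differentiable.differentiableAt hg.differentiable.differentiableAt]
    rfl
  have ibp := integral_mul_fderiv_eq_neg_fderiv_mul_of_integrable
    (μ := (volume : Measure (Vec d))) (f := fun y => f y * g y) (g := h)
    (v := EuclideanSpace.single k (1 : ℝ))
    (by
      simp_rw [hd, add_mul]
      exact i1.add i3)
    (i2.congr (Eventually.of_forall fun x => by simp only [partialDeriv]; ring)) i4
    (fun x _ => (hf.differentiable.mul hg.differentiable).differentiableAt)
    (fun x _ => hh.differentiable.differentiableAt)
  simp_rw [hd, add_mul] at ibp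
  rw [integral_add i1 i3] at ibp
  -- Each integrand contains an undifferentiated factor supported in Ω, so integrals over Ω and over
  -- the whole space agree.
  have e : ∀ F : Vec d → ℝ, F.support ⊆ Ω → ∫ x in Ω, F x = ∫ x, F x := fun F hF =>
    setIntegral_eq_integral_of_forall_compl_eq_zero fun x hx =>
      Function.notMem_support.1 fun hx' => hx (hF hx')
  have sh : h.support ⊆ Ω := (subset_tsupport h).trans hh.2.2
  have sg : g.support ⊆ Ω := (subset_tsupport g).trans hg.2.2
  rw [e _ ((Function.support_mul_subset_right _ _).trans sh),
    e _ ((Function.support_mul_subset_right _ _).trans sg),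
    e _ ((Function.support_mul_subset_right _ _).trans sh)]
  have e2 : ∫ x, f x * partialDeriv k h x * g x
      = ∫ x, f x * g x * fderiv ℝ h x (EuclideanSpace.single k (1 : ℝ)) := by
    congr 1
    ext x
    simp only [partialDeriv]
    ring
  rw [e2, ibp]
  ring

theorem tri_eq_of_ae {w u v : L2Vec Ω × L2Mat Ω} {φ ψ χ : Vec d → Vec d} (k l m i : Fin d)
    (h1 : ∀ᵐ x ∂(volume.restrict Ω), w.1 x = φ x)
    (h2 : ∀ᵐ x ∂(volume.restrict Ω), u.2 x = classicalGrad ψ x)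
    (h3 : ∀ᵐ x ∂(volume.restrict Ω), v.1 x = χ x) (hψ : Differentiable ℝ ψ) :
    tri k l m i w u v = ∫ x in Ω, φ x k * partialDeriv l (fun y => ψ y m) x * χ x i := by
  apply integral_congr_ae
  filter_upwards [h1, h2, h3] with x e1 e2 e3
  rw [e1, e2, e3, partialDeriv_apply_coord hψ.differentiableAt]
  rfl

theorem testPairs_subset_testClosure {p : L2Vec Ω × L2Mat Ω} (hp : p ∈ testPairs Ω) :
    p ∈ testClosure Ω :=
  (testSubmodule Ω).le_topologicalClosure hp

/-- Integration by parts, `((w · ∇) u, v) + ((w · ∇) v, u) + ((∇ · w) u, v) = 0`, for each pair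
of components. -/
theorem tri_product_rule {C : ℝ≥0} (hC : IsSobolevConst Ω C) (k i : Fin d)
    {w u v : L2Vec Ω × L2Mat Ω} (hw : w ∈ testClosure Ω) (hu : u ∈ testClosure Ω)
    (hv : v ∈ testClosure Ω) :
    tri k k i i w u v + tri k k i i w v u + tri i k k i u w v = 0 := by
  obtain ⟨a, ha, hal⟩ := exists_seq_testPairs hw
  obtain ⟨b, hb, hbl⟩ := exists_seq_testPairs hu
  obtain ⟨c, hc, hcl⟩ := exists_seq_testPairs hv
  have ha' := fun n => testPairs_subset_testClosure (ha n)
  have hb' := fun n => testPairs_subset_testClosure (hb n)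
  have hc' := fun n => testPairs_subset_testClosure (hc n)
  have key : ∀ n m l, tri k k i i (a n) (b m) (c l) + tri k k i i (a n) (c l) (b m)
      + tri i k k i (b m) (a n) (c l) = 0 := by
    intro n m l
    obtain ⟨φ, hφ, f1, f2⟩ := ha n
    obtain ⟨ψ, hψ, g1, g2⟩ := hb m
    obtain ⟨χ, hχ, h1, h2⟩ := hc l
    rw [tri_eq_of_ae k k i i f1 g2 h1 hψ.differentiable,
      tri_eq_of_ae k k i i f1 h2 g1 hχ.differentiable,
      tri_eq_of_ae i k k i g1 f2 h1 hφ.differentiable]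
    exact integral_testFun_product_rule (hφ.coord k) (hψ.coord i) (hχ.coord i) k
  -- The three limits are taken one at a time, with the other two arguments fixed; separate
  -- continuity is then enough.
  have key1 : ∀ m l, tri k k i i w (b m) (c l) + tri k k i i w (c l) (b m)
      + tri i k k i (b m) w (c l) = 0 := fun m l =>
    tendsto_nhds_unique (((tendsto_tri_left hC k k i i hw ha' hal (b m) (hc' l)).add
      (tendsto_tri_left hC k k i i hw ha' hal (c l) (hb' m))).add
      (tendsto_tri_mid hC i k k i (hb' m) (hc' l) hal))
      (by simp_rw [key]; exact tendsto_const_nhds)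
  have key2 : ∀ l, tri k k i i w u (c l) + tri k k i i w (c l) u
      + tri i k k i u w (c l) = 0 := fun l =>
    tendsto_nhds_unique (((tendsto_tri_mid hC k k i i hw (hc' l) hbl).add
      (tendsto_tri_right hC k k i i hw hb' (c l) hu hbl)).add
      (tendsto_tri_left hC i k k i hu hb' hbl w (hc' l)))
      (by simp_rw [key1]; exact tendsto_const_nhds)
  exact tendsto_nhds_unique (((tendsto_tri_right hC k k i i hw hc' u hv hcl).add
      (tendsto_tri_mid hC k k i i hw hu hcl)).add
      (tendsto_tri_right hC i k k i hu hc' w hv hcl))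
      (by simp_rw [key2]; exact tendsto_const_nhds)

theorem convForm_eq_sum_tri {C : ℝ≥0} (hC : IsSobolevConst Ω C) (w u v : X Ω) :
    convForm w u v = ∑ k, ∑ i, tri k k i i w.1 u.1 v.1 := by
  have hI := fun k i : Fin d => tri_integrable hC k k i i (X_le_testClosure w.2) u.1
    (X_le_testClosure v.2)
  simp only [convForm, tri, fn, grad]
  rw [integral_finsetSum _ fun k _ => integrable_finsetSum _ fun i _ => hI k i]
  exact Finset.sum_congr rfl fun k _ => integral_finsetSum _ fun i _ => hI k i

theorem abs_sum_sum_le {F : Fin d → Fin d → ℝ} {M : ℝ} (h : ∀ k i, |F k i| ≤ M) :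
    |∑ k, ∑ i, F k i| ≤ d ^ 2 * M := by
  calc |∑ k, ∑ i, F k i| ≤ ∑ k, ∑ i, |F k i| :=
        (Finset.abs_sum_le_sum_abs _ _).trans
          (Finset.sum_le_sum fun k _ => Finset.abs_sum_le_sum_abs _ _)
    _ ≤ ∑ _k : Fin d, ∑ _i : Fin d, M :=
        Finset.sum_le_sum fun k _ => Finset.sum_le_sum fun i _ => h k i
    _ = d ^ 2 * M := by simp; ring

/-- With $K=d^2C^{3/2}$, the first bound needs $\tfrac32K$ and the second $K$; the factor 2 covers
both, and the added 1 makes the constant strictly positive. -/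
theorem IsSobolevConst.isTrilinearConst {C : ℝ≥0} (hC : IsSobolevConst Ω C) :
    IsTrilinearConst Ω (2 * (d ^ 2 * (C * √C)) + 1) := by
  have hX : ∀ p : X Ω, p.1 ∈ testClosure Ω := fun p => X_le_testClosure p.2
  refine ⟨fun u v w => ?_, fun u v w => ?_⟩
  -- The term $(w\cdot\nabla v,u)$ has the full gradient on $v$ and cannot give $(\|v\|\,\|\nabla
  -- v\|)^{1/2}$. Integration by parts removes it: $b^*(w,u,v)=(w\cdot\nabla
  -- u,v)+\tfrac12((\nabla\cdot w)u,v)$.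
  · have h1 : |∑ k, ∑ i, tri k k i i w.1 u.1 v.1| ≤ _ :=
      abs_sum_sum_le fun k i => abs_tri_le hC k k i i (hX w) u.1 (hX v)
    have h2 : |∑ k, ∑ i, tri i k k i u.1 w.1 v.1| ≤ _ :=
      abs_sum_sum_le fun k i => abs_tri_le hC i k k i (hX u) w.1 (hX v)
    have h3 : (∑ k, ∑ i, tri k k i i w.1 u.1 v.1) + (∑ k, ∑ i, tri k k i i w.1 v.1 u.1)
        + (∑ k, ∑ i, tri i k k i u.1 w.1 v.1) = 0 := by
      simp_rw [← Finset.sum_add_distrib, tri_product_rule hC _ _ (hX w) (hX u) (hX v)]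
      simp
    rw [bStar, convForm_eq_sum_tri hC, convForm_eq_sum_tri hC]
    have h1' := (abs_le.1 h1).2
    have h2' := (abs_le.1 h2).2
    have pos : 0 ≤ ‖w.1.2‖ * ‖u.1.2‖ * √(‖v.1.1‖ * ‖v.1.2‖) := by positivity
    have pos' : 0 ≤ d ^ 2 * (C * √C) * (‖w.1.2‖ * ‖u.1.2‖ * √(‖v.1.1‖ * ‖v.1.2‖)) := by positivity
    simp only [fn, grad]
    linarith
  -- Here the interpolated factor is $w$, so after the swap both halves of $b^*$ are bounded
  -- directly.
  · have h1 : |∑ k, ∑ i, tri k k i i w.1 u.1 v.1| ≤ _ :=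
      abs_sum_sum_le fun k i => (tri_swap k k i i w.1 u.1 v.1) ▸
        abs_tri_le hC i k i k (hX v) u.1 (hX w)
    have h2 : |∑ k, ∑ i, tri k k i i w.1 v.1 u.1| ≤ _ :=
      abs_sum_sum_le fun k i => (tri_swap k k i i w.1 v.1 u.1) ▸
        abs_tri_le hC i k i k (hX u) v.1 (hX w)
    rw [bStar, convForm_eq_sum_tri hC, convForm_eq_sum_tri hC]
    have h1' := (abs_le.1 h1).2
    have h2' := (abs_le.1 h2).1
    have pos : 0 ≤ √(‖w.1.1‖ * ‖w.1.2‖) * ‖u.1.2‖ * ‖v.1.2‖ := by positivity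
    have pos' : 0 ≤ d ^ 2 * (C * √C) * (√(‖w.1.1‖ * ‖w.1.2‖) * ‖u.1.2‖ * ‖v.1.2‖) := by positivity
    simp only [fn, grad]
    linarith

theorem convForm_sub_mid {C : ℝ≥0} (hC : IsSobolevConst Ω C) (w u u' v : X Ω) :
    convForm w (u - u') v = convForm w u v - convForm w u' v := by
  simp_rw [convForm_eq_sum_tri hC, ← Finset.sum_sub_distrib]
  exact Finset.sum_congr rfl fun k _ => Finset.sum_congr rfl fun i _ =>
    tri_sub_mid hC k k i i (X_le_testClosure w.2) _ _ (X_le_testClosure v.2)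

theorem convForm_sub_right {C : ℝ≥0} (hC : IsSobolevConst Ω C) (w u v v' : X Ω) :
    convForm w u (v - v') = convForm w u v - convForm w u v' := by
  simp_rw [convForm_eq_sum_tri hC, ← Finset.sum_sub_distrib]
  exact Finset.sum_congr rfl fun k _ => Finset.sum_congr rfl fun i _ =>
    tri_sub_right hC k k i i (X_le_testClosure w.2) _ (X_le_testClosure v.2)
      (X_le_testClosure v'.2)

theorem bStar_self (w u : X Ω) : bStar w u u = 0 := by
  simp [bStar]

theorem bStar_sub_right {C : ℝ≥0} (hC : IsSobolevConst Ω C) (w u v v' : X Ω) :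
    bStar w u (v - v') = bStar w u v - bStar w u v' := by
  rw [bStar, bStar, bStar, convForm_sub_mid hC, convForm_sub_right hC]
  ring

end TrilinearForm

end LerayPOD

namespace LerayPOD

open Filter Topology
open scoped ENNReal NNReal

/-! ### Energy estimate for the ensemble scheme. -/

section Stability

variable {d : ℕ} {Ω : Set (Vec d)}

theorem fn_sub (u v : X Ω) : fn (u - v) = fn u - fn v := rfl

theorem norm_eq_max_fn_grad (u : X Ω) : ‖u‖ = max ‖fn u‖ ‖grad u‖ := rfl

/-- The pairing is bounded by the dual norm, `(f, v) ≤ ‖f‖₋₁ ‖∇v‖`. -/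
theorem apply_le_dualNorm_mul {c : ℝ} (hc : 0 ≤ c) (hP : ∀ v : X Ω, ‖fn v‖ ≤ c * ‖grad v‖)
    (f : StrongDual ℝ (X Ω)) (v : X Ω) : f v ≤ dualNorm f * ‖grad v‖ := by
  by_cases hv : v = 0
  · subst hv
    rw [map_zero]
    exact le_of_eq (by simp [grad])
  have hle : ∀ w : X Ω, ‖w‖ ≤ (c + 1) * ‖grad w‖ := fun w => by
    rw [norm_eq_max_fn_grad]
    have := norm_nonneg (grad w)
    have := hP w
    exact max_le (by linarith) (by nlinarith)
  have hpos : ∀ w : X Ω, w ≠ 0 → 0 < ‖grad w‖ := fun w hw => by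
    have := (norm_pos_iff.2 hw).trans_le (hle w)
    exact pos_of_mul_pos_right this (by linarith)
  -- An unbounded set would have `sSup` equal to 0. Boundedness comes from the Poincaré inequality,
  -- which controls the norm of `X Ω` by the gradient alone.
  have hbdd : BddAbove {r : ℝ | ∃ w : X Ω, w ≠ 0 ∧ r = f w / ‖grad w‖} := by
    refine ⟨‖f‖ * (c + 1), ?_⟩
    rintro r ⟨w, hw, rfl⟩
    rw [div_le_iff₀ (hpos w hw), mul_assoc]
    exact (le_abs_self _).trans ((f.le_opNorm w).trans
      (mul_le_mul_of_nonneg_left (hle w) (norm_nonneg f)))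
  rw [← div_le_iff₀ (hpos v hv)]
  exact le_csSup hbdd ⟨v, hv, rfl⟩

/-- The POD inverse inequality `‖∇v‖² ≤ |||S_R|||₂ ‖v‖²`. -/
theorem norm_grad_sq_le_of_mem_podSpace {R : ℕ} {φ : Fin R → X Ω} (hφ : IsL2Orthonormal φ)
    {v : X Ω} (hv : v ∈ podSpace φ) :
    ‖grad v‖ ^ 2 ≤ matrixTwoNorm (stiffness φ) * ‖fn v‖ ^ 2 := by
  obtain ⟨c, rfl⟩ := (Submodule.mem_span_range_iff_exists_fun ℝ).1 hv
  have hfn : fn (∑ i, c i • φ i) = ∑ i, c i • fn (φ i) :=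
    (map_sum ((LinearMap.fst ℝ _ _).comp (X Ω).subtype) _ _).trans rfl
  have hgrad : grad (∑ i, c i • φ i) = ∑ i, c i • grad (φ i) :=
    (map_sum ((LinearMap.snd ℝ _ _).comp (X Ω).subtype) _ _).trans rfl
  -- In POD coordinates $\|v\|=|x|$ by orthonormality, and $\|\nabla v\|^2$ is the quadratic form of
  -- the stiffness matrix at $x$.
  let x : EuclideanSpace ℝ (Fin R) := WithLp.toLp 2 c
  have hx : ‖fn (∑ i, c i • φ i)‖ ^ 2 = ‖x‖ ^ 2 := by
    rw [hfn, ← real_inner_self_eq_norm_sq, hφ.inner_sum c c Finset.univ,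
      EuclideanSpace.norm_sq_eq]
    refine Finset.sum_congr rfl fun i _ => ?_
    simp [x, sq]
  have hS : ‖grad (∑ i, c i • φ i)‖ ^ 2
      = inner ℝ x (Matrix.toEuclideanCLM (n := Fin R) (𝕜 := ℝ) (stiffness φ) x) := by
    rw [hgrad, ← real_inner_self_eq_norm_sq, sum_inner, PiLp.inner_apply]
    refine Finset.sum_congr rfl fun i _ => ?_
    simp only [inner_sum, real_inner_smul_left, real_inner_smul_right, x,
      Matrix.toEuclideanCLM_toLp, Matrix.mulVec, dotProduct, stiffness, Matrix.of_apply,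
      RCLike.inner_apply, conj_trivial, Finset.sum_mul]
    refine Finset.sum_congr rfl fun j _ => ?_
    ring
  rw [hx, hS]
  calc _ ≤ ‖x‖ * ‖Matrix.toEuclideanCLM (n := Fin R) (𝕜 := ℝ) (stiffness φ) x‖ :=
        real_inner_le_norm _ _
    _ ≤ ‖x‖ * (matrixTwoNorm (stiffness φ) * ‖x‖) := by
        gcongr
        exact ContinuousLinearMap.le_opNorm _ _
    _ = _ := by ring

/-- Young's inequality for the convective term under the inverse inequality `g² ≤ S m²`. -/
theorem mul_sqrt_mul_le_of_sq_le {Cb Δt νmax ε S m g W U : ℝ} (hΔt : 0 < Δt) (hν : 0 < νmax)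
    (hS : 0 ≤ S) (hm : 0 ≤ m) (hW : 0 ≤ W) (hU : 0 ≤ U) (hgm : g ^ 2 ≤ S * m ^ 2)
    (hcond : Cb ^ 2 * Δt / νmax * √S * W ^ 2 ≤ ε) :
    Cb * W * U * √(m * g) ≤ 1 / (2 * Δt) * m ^ 2 + νmax * ε / 2 * U ^ 2 := by
  -- Here $r=S^{1/4}$, since $g\le S^{1/2}m$ gives $\sqrt{mg}\le S^{1/4}m$.
  obtain ⟨r, hr0, hr2⟩ : ∃ r : ℝ, 0 ≤ r ∧ r ^ 2 = √S :=
    ⟨√(√S), Real.sqrt_nonneg _, Real.sq_sqrt (Real.sqrt_nonneg _)⟩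
  have h3 : g ≤ √S * m := by
    refine abs_le_of_sq_le_sq' ?_ (by positivity) |>.2
    rwa [mul_pow, Real.sq_sqrt hS]
  have h4 : √(m * g) ≤ r * m := by
    rw [Real.sqrt_le_left (by positivity), mul_pow, hr2]
    calc m * g ≤ m * (√S * m) := by gcongr
      _ = _ := by ring
  -- The sign of `Cb` is not known, so its absolute value enters; only its square survives.
  obtain ⟨q, hq⟩ : ∃ q, q = |Cb| * W * U * r := ⟨_, rfl⟩
  have h5 : Cb * W * U * √(m * g) ≤ q * m :=
    calc Cb * W * U * √(m * g) ≤ |Cb| * W * U * (r * m) := by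
          gcongr
          exact le_abs_self Cb
      _ = q * m := by rw [hq]; ring
  -- The Young weight is fixed by the available numerical dissipation, whose coefficient is exactly
  -- $1/(2\Delta t)$.
  have h6 : q * m ≤ 1 / (2 * Δt) * m ^ 2 + Δt / 2 * q ^ 2 := by
    have : 1 / (2 * Δt) * m ^ 2 + Δt / 2 * q ^ 2 - q * m = (m - Δt * q) ^ 2 / (2 * Δt) := by
      field_simp
      ring
    have : 0 ≤ (m - Δt * q) ^ 2 / (2 * Δt) := by positivity
    linarith
  have h7 : Δt / 2 * q ^ 2 ≤ νmax * ε / 2 * U ^ 2 :=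
    calc Δt / 2 * q ^ 2 = (νmax / 2 * U ^ 2) * (Cb ^ 2 * Δt / νmax * √S * W ^ 2) := by
          rw [hq, mul_pow, mul_pow, mul_pow, sq_abs, hr2]
          field_simp
      _ ≤ (νmax / 2 * U ^ 2) * ε := by gcongr
      _ = _ := by ring
  linarith

/-- The convective term is absorbed by the numerical dissipation and the viscous term. -/
theorem neg_bStar_le {C : ℝ≥0} (hC : IsSobolevConst Ω C) {Cb : ℝ} (hCb : IsTrilinearConst Ω Cb)
    {R : ℕ} {φ : Fin R → X Ω} (hφ : IsL2Orthonormal φ) {w u v : X Ω} (hu : u ∈ podSpace φ)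
    (hv : v ∈ podSpace φ) {Δt νmax ε : ℝ} (hΔt : 0 < Δt) (hν : 0 < νmax)
    (hcond : Cb ^ 2 * Δt / νmax * √(matrixTwoNorm (stiffness φ)) * ‖grad w‖ ^ 2 ≤ ε) :
    -bStar w u v ≤ 1 / (2 * Δt) * ‖fn v - fn u‖ ^ 2 + νmax * ε / 2 * ‖grad u‖ ^ 2 := by
  -- Subtracting $v$ from $u$ costs nothing, as $b^*(w,u,u)=0$, and puts the time increment into the
  -- interpolated slot of the first bound.
  have h1 : -bStar w u v = bStar w u (u - v) := by
    rw [bStar_sub_right hC, bStar_self, zero_sub]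
  rw [h1, norm_sub_rev, ← fn_sub]
  exact (hCb.1 u (u - v) w).trans (mul_sqrt_mul_le_of_sq_le hΔt hν (norm_nonneg _)
    (norm_nonneg _) (norm_nonneg _) (norm_nonneg _)
    (norm_grad_sq_le_of_mem_podSpace hφ (sub_mem hu hv)) hcond)

/-- One step of the scheme does not increase the energy, up to
the contribution of the force. -/
theorem energy_step {C : ℝ≥0} (hC : IsSobolevConst Ω C) {c : ℝ} (hc : 0 ≤ c)
    (hP : ∀ v : X Ω, ‖fn v‖ ≤ c * ‖grad v‖) {Cb : ℝ} (hCb : IsTrilinearConst Ω Cb)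
    {R : ℕ} {φ : Fin R → X Ω} (hφ : IsL2Orthonormal φ) {w z u v : X Ω} (hu : u ∈ podSpace φ)
    (hv : v ∈ podSpace φ) {Δt ν νmax ε : ℝ} (hΔt : 0 < Δt) (hνmax : 0 < νmax) (hε : 0 < ε)
    (hν : |ν - νmax| ≤ (1 - ε) * νmax) (f : StrongDual ℝ (X Ω))
    (hcond : Cb ^ 2 * Δt / νmax * √(matrixTwoNorm (stiffness φ)) * ‖grad w‖ ^ 2 ≤ ε)
    (hstep : (inner ℝ ((1 / Δt) • (fn v - fn u)) (fn v) : ℝ) + bStar z v v + bStar w u v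
      + νmax * (inner ℝ (grad v) (grad v) : ℝ)
      + (ν - νmax) * (inner ℝ (grad u) (grad v) : ℝ) = f v) :
    1 / 2 * ‖fn v‖ ^ 2 + νmax * Δt / 2 * ‖grad v‖ ^ 2 + ε * νmax * Δt / 4 * ‖grad v‖ ^ 2
      ≤ Δt / (νmax * ε) * dualNorm f ^ 2 + 1 / 2 * ‖fn u‖ ^ 2
        + νmax * Δt / 2 * ‖grad u‖ ^ 2 := by
  have h1 := neg_bStar_le hC hCb hφ hu hv hΔt hνmax hcond
  have h2 := apply_le_dualNorm_mul hc hP f v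
  have h3 : dualNorm f * ‖grad v‖
      ≤ dualNorm f ^ 2 / (νmax * ε) + νmax * ε / 4 * ‖grad v‖ ^ 2 := by
    have e : dualNorm f ^ 2 / (νmax * ε) + νmax * ε / 4 * ‖grad v‖ ^ 2 - dualNorm f * ‖grad v‖
        = (dualNorm f - νmax * ε / 2 * ‖grad v‖) ^ 2 / (νmax * ε) := by
      field_simp
      ring
    have : 0 ≤ (dualNorm f - νmax * ε / 2 * ‖grad v‖) ^ 2 / (νmax * ε) := by positivity
    linarith
  have h4 : -((ν - νmax) * (inner ℝ (grad u) (grad v) : ℝ))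
      ≤ (1 - ε) * νmax * (‖grad u‖ ^ 2 / 2 + ‖grad v‖ ^ 2 / 2) := by
    have a1 : ‖grad u‖ * ‖grad v‖ ≤ ‖grad u‖ ^ 2 / 2 + ‖grad v‖ ^ 2 / 2 := by
      nlinarith [sq_nonneg (‖grad u‖ - ‖grad v‖)]
    calc _ ≤ |(ν - νmax) * (inner ℝ (grad u) (grad v) : ℝ)| := neg_le_abs _
      _ = |ν - νmax| * |(inner ℝ (grad u) (grad v) : ℝ)| := abs_mul _ _
      _ ≤ |ν - νmax| * (‖grad u‖ * ‖grad v‖) := by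
          gcongr
          exact abs_real_inner_le_norm _ _
      _ ≤ |ν - νmax| * (‖grad u‖ ^ 2 / 2 + ‖grad v‖ ^ 2 / 2) := by gcongr
      _ ≤ _ := by gcongr
  -- Polarization: implicit Euler produces the dissipation $\|v-u\|^2$ that absorbs the lagged
  -- convective term.
  have h5 : (inner ℝ ((1 / Δt) • (fn v - fn u)) (fn v) : ℝ)
      = 1 / (2 * Δt) * (‖fn v‖ ^ 2 - ‖fn u‖ ^ 2 + ‖fn v - fn u‖ ^ 2) := by
    rw [real_inner_smul_left, inner_sub_left, real_inner_self_eq_norm_sq,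
      norm_sub_sq_real, real_inner_comm (fn u) (fn v)]
    field_simp
    ring
  rw [h5, bStar_self, real_inner_self_eq_norm_sq] at hstep
  -- The $\|v-u\|^2$ terms cancel. In units of $\nu_{max}$, the left keeps
  -- $1-\frac{1-\epsilon}2-\frac\epsilon4=\frac12+\frac\epsilon4$ of $\|\nabla v\|^2$, and the right
  -- collects $\frac\epsilon2+\frac{1-\epsilon}2=\frac12$ of $\|\nabla u\|^2$. The equal halves are
  -- what telescopes.
  have key : 1 / (2 * Δt) * (‖fn v‖ ^ 2 - ‖fn u‖ ^ 2)
      + (1 / 2 + ε / 4) * νmax * ‖grad v‖ ^ 2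
      ≤ dualNorm f ^ 2 / (νmax * ε) + νmax / 2 * ‖grad u‖ ^ 2 := by
    linarith
  have key' := mul_le_mul_of_nonneg_left key hΔt.le
  have e1 : Δt * (1 / (2 * Δt) * (‖fn v‖ ^ 2 - ‖fn u‖ ^ 2)
      + (1 / 2 + ε / 4) * νmax * ‖grad v‖ ^ 2) = 1 / 2 * (‖fn v‖ ^ 2 - ‖fn u‖ ^ 2)
      + Δt * ((1 / 2 + ε / 4) * νmax * ‖grad v‖ ^ 2) := by
    field_simp
  have e2 : Δt / (νmax * ε) * dualNorm f ^ 2 = Δt * (dualNorm f ^ 2 / (νmax * ε)) := by ring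
  rw [e1] at key'
  rw [e2]
  linarith

theorem le_add_sum_range_of_forall_le {E D G : ℕ → ℝ} {N : ℕ}
    (h : ∀ n < N, E (n + 1) + D n ≤ G n + E n) :
    E N + ∑ n ∈ Finset.range N, D n ≤ ∑ n ∈ Finset.range N, G n + E 0 := by
  induction N with
  | zero => simp
  | succ N ih =>
    have h1 := ih fun n hn => h n (hn.trans N.lt_succ_self)
    have h2 := h N N.lt_succ_self
    rw [Finset.sum_range_succ, Finset.sum_range_succ]
    linarith

end Stability

end LerayPOD

/-! ### The stability theorem. -/

theorem mainTheorem1 (d : ℕ) (hd : d = 2 ∨ d = 3) (Ω : Set (Vec d)) (hΩ : IsOpen Ω)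
    (hΩb : Bornology.IsBounded Ω) :
    (∃ C : ℝ, 0 < C ∧ IsTrilinearConst Ω C) ∧
    ∀ Cb : ℝ, IsTrilinearConst Ω Cb →
    ∀ (Xh : Submodule ℝ (X Ω)) (Qh : Submodule ℝ (L2Scal Ω)),
      FiniteDimensional ℝ Xh → FiniteDimensional ℝ Qh → (Qh : Set (L2Scal Ω)) ⊆ pressureSpace Ω →
    ∀ (JS NS R : ℕ) (s : Fin JS → Fin (NS + 1) → X Ω),
      (∀ k l, IsDiscretelyDivFree Xh Qh (s k l)) →
    ∀ φ : Fin R → X Ω, IsPODBasis s φ →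
    ∀ (J N : ℕ) (δ Δt νmax ε : ℝ) (ν : Fin J → ℝ) (f : Fin J → ℕ → StrongDual ℝ (X Ω))
      (u : Fin J → ℕ → X Ω),
      1 ≤ N → 0 < δ → 0 < Δt → (∀ j, 0 < ν j) →
      IsGreatest (Set.range ν) νmax →
      IsGreatest (Set.range fun j => |ν j - νmax| / νmax) (1 - ε) →
      IsLerayEnsemblePOD (podSpace φ) δ Δt νmax ν f N u →
      (∀ j, ∀ n < N,
        Cb ^ 2 * Δt / νmax * Real.sqrt (matrixTwoNorm (stiffness φ))
          * ‖grad (romFilter δ (podSpace φ) (u j n - ensMean u n))‖ ^ 2 ≤ ε) →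
      ∀ j,
        1 / 2 * ‖fn (u j N)‖ ^ 2 + νmax * Δt / 2 * ‖grad (u j N)‖ ^ 2
            + ε * νmax * Δt / 4 * ∑ n ∈ Finset.range N, ‖grad (u j (n + 1))‖ ^ 2
          ≤ ∑ n ∈ Finset.range N, Δt / (νmax * ε) * dualNorm (f j (n + 1)) ^ 2
            + 1 / 2 * ‖fn (u j 0)‖ ^ 2 + νmax * Δt / 2 * ‖grad (u j 0)‖ ^ 2 := by
  obtain ⟨C, hC⟩ : ∃ C, IsSobolevConst Ω C := exists_sobolev hd hΩb hΩ.measurableSet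
  obtain ⟨c, hc, hP⟩ := exists_poincare hd hΩb hΩ.measurableSet
  refine ⟨⟨_, by positivity, hC.isTrilinearConst⟩, ?_⟩
  intro Cb hCb Xh Qh _ _ _ JS NS R s _ φ hφ J N δ Δt νmax ε ν f u _ _ hΔt hν hmax hε hu hcond j
  obtain ⟨j₀, hj₀⟩ := hmax.1
  obtain ⟨j₁, hj₁⟩ := hε.1
  have hνmax : 0 < νmax := hj₀ ▸ hν j₀
  have hle : ν j₁ ≤ νmax := hmax.2 ⟨j₁, rfl⟩
  -- The maximal deviation is attained at `j₁`, and $0<\nu_{j_1}\le\nu_{max}$ makes it strictly less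
  -- than 1.
  have hε0 : 0 < ε := by
    have h1 : |ν j₁ - νmax| / νmax < 1 := by
      rw [div_lt_one hνmax, abs_of_nonpos (by linarith)]
      linarith [hν j₁]
    simp only at hj₁
    linarith
  have hsplit : |ν j - νmax| ≤ (1 - ε) * νmax := by
    rw [← div_le_iff₀ hνmax]
    exact hε.2 ⟨j, rfl⟩
  have h := le_add_sum_range_of_forall_le (N := N)
    (E := fun n => 1 / 2 * ‖fn (u j n)‖ ^ 2 + νmax * Δt / 2 * ‖grad (u j n)‖ ^ 2)
    (D := fun n => ε * νmax * Δt / 4 * ‖grad (u j (n + 1))‖ ^ 2)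
    (G := fun n => Δt / (νmax * ε) * dualNorm (f j (n + 1)) ^ 2) fun n hn => by
      rw [← add_assoc]
      -- The scheme is tested with $u_R^{j,n+1}$, which is admissible because it lies in $X_R$.
      exact energy_step hC hc (fun v => hP v.1 (X_le_testClosure v.2)) hCb hφ.2.1
        (hu.1 j n hn.le) (hu.1 j (n + 1) hn) hΔt hνmax hε0 hsplit (f j (n + 1)) (hcond j n hn)
        (hu.2 j n hn _ (hu.1 j (n + 1) hn))
  rw [← Finset.mul_sum, ← add_assoc] at h
  exact h
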